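/- Conventions. Let $\mathcal T$ be a triangulated category with small coproducts, with shift functor $\Sigma$. An object $c$ of a triangulated category $\mathcal S$ (which need not have coproducts) is compact if $\mathrm{Hom}(c,-)$ respects all small coproducts that exist in $\mathcal S$; $\mathcal S^c$ is the full subcategory of compact objects. A compact generator of $\mathcal T$ is a compact object $G$ such that $\mathrm{Hom}(\Sigma^iG,X)=0$ for all $i\in\mathbb Z$ implies $X=0$. For full subcategories $\mathcal A,\mathcal B$, $\mathcal A*\mathcal B$ consists of the objects $x$ admitting a distinguished triangle $a\to x\to b\to\Sigma a$ with $a\in\mathcal A$, $b\in\mathcal B$; $\mathrm{Coprod}(\mathcal A)$ is the smallest full subcategory containing $\mathcal A$ and closed under extensions and small coproducts. Put $G[m,n]=\{\Sigma^iG : m\le -i\le n\}$, $G(-\infty,0]=\{\Sigma^iG: i\ge 0\}$. The category $\mathcal T$ is weakly approximable if there are an integer $A>0$, a compact generator $G$ and a t-structure $(\mathcal T^{\le0},\mathcal T^{\ge1})$ such that (i) $G\in\mathcal T^{\le A}$ and $\mathrm{Hom}(G,\mathcal T^{\le -A})=0$; (ii) every $F\in\mathcal T^{\le0}$ sits in a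 distinguished triangle $E\to F\to D\to\Sigma E$ with $D\in\mathcal T^{\le-1}$ and $E$ a direct summand of an object of $\mathrm{Coprod}(G[-A,A])$. A t-structure is in the preferred equivalence class if for some compact generator $G$ and some integer $N>0$ one has $\mathcal T^{\le-N}\subseteq\mathrm{Coprod}(G(-\infty,0])\subseteq\mathcal T^{\le N}$. For such a t-structure put $\mathcal T^-=\bigcup_m\mathcal T^{\le m}$, $\mathcal T^+=\bigcup_m\mathcal T^{\ge -m}$, $\mathcal T^b=\mathcal T^-\cap\mathcal T^+$ and $\mathcal T^-_c=\bigcap_{m>0}(\mathcal T^c*\mathcal T^{\le-m})$. Statement. Let $\mathcal T$ be weakly approximable, with a t-structure in the preferred equivalence class. (1) $(\mathcal T^-)^c=\mathcal T^c$: an object of $\mathcal T$ is compact in $\mathcal T$ if and only if it lies in $\mathcal T^-$ and is compact in the triangulated category $\mathcal T^-$. (2) $\mathcal T^-_c\subseteq\mathcal T^-$, and the inclusions $\mathcal T^b\subseteq\mathcal T^-$, $\mathcal T^-_c\subseteq\mathcal T^-$ and $\mathcal T^b\subseteq\mathcal T^+$ are intrinsic, that is, invariant under triangulated equivalences: if $\mathcal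 T'$ is another weakly approximable triangulated category, with a t-structure in its preferred equivalence class, then every triangulated equivalence $\mathcal T^-\to\mathcal T'^-$ restricts to triangulated equivalences $\mathcal T^b\to\mathcal T'^b$ and $\mathcal T^-_c\to\mathcal T'^-_c$, and every triangulated equivalence $\mathcal T^+\to\mathcal T'^+$ restricts to a triangulated equivalence $\mathcal T^b\to\mathcal T'^b$. -/

import Mathlib

open CategoryTheory CategoryTheory.Limits CategoryTheory.Triangulated
open CategoryTheory.Pretriangulated

universe v u u'

namespace WeakApprox

/-- The compact objects of a preadditive category `C` with morphisms in `Type v`: those `c` for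
which `Hom(c, -) : C ⥤ Ab` respects all the coproducts of small families (indexed by a
`J : Type v`) that exist in `C`. The category `C` is not assumed to have coproducts. -/
def compactObjects (C : Type u) [Category.{v} C] [Preadditive C] : ObjectProperty C :=
  fun c => ∀ J : Type v,
    PreservesColimitsOfShape (Discrete J) (preadditiveCoyoneda.obj (Opposite.op c))

section Triangulated

variable {C : Type u} [Category.{v} C] [Preadditive C] [HasZeroObject C] [HasShift C ℤ]
  [∀ n : ℤ, (shiftFunctor C n).Additive] [Pretriangulated C]

/-- `G` is a compact generator: it is compact, and only the zero objects receive no nonzero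
morphism from any of the shifts of `G`. -/
def IsCompactGenerator (G : C) : Prop :=
  compactObjects C G ∧
    ∀ X : C, (∀ (i : ℤ) (f : (shiftFunctor C i).obj G ⟶ X), f = 0) → IsZero X

/-- For a set `s` of integers (usually an interval), the objects isomorphic to a shift `G⟦i⟧`
with `-i ∈ s`. Thus `shiftsOf G (Set.Icc m n)` is `G[m,n]`, and `shiftsOf G (Set.Iic n)` is
`G(-∞,n]`. -/
def shiftsOf (G : C) (s : Set ℤ) : ObjectProperty C :=
  fun X => ∃ i : ℤ, -i ∈ s ∧ Nonempty (X ≅ (shiftFunctor C i).obj G)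

/-- `Coprod(P)`: the smallest full subcategory which contains `P` and is closed under extensions
and under small coproducts. -/
def coprodClosure (P : ObjectProperty C) : ObjectProperty C :=
  fun X => ∀ S : ObjectProperty C, P ≤ S → ObjectProperty.extensionProduct S S ≤ S →
    (∀ J : Type v, S.IsClosedUnderColimitsOfShape (Discrete J)) → S X

variable (C) in
/-- Weak approximability of a triangulated category (the existence of coproducts is a separate
assumption). The last condition says that each `F` in `T^{≤ 0}` is the middle term of a
distinguished triangle `E ⟶ F ⟶ D ⟶ E⟦1⟧` where `D` is in `T^{≤ -1}` and `E` is a direct summand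
of an object of `Coprod(G[-A,A])`. -/
def IsWeaklyApproximable : Prop :=
  ∃ (A : ℤ) (G : C) (t : TStructure C), 0 < A ∧ IsCompactGenerator G ∧
    t.le A G ∧ (∀ (Y : C) (f : G ⟶ Y), t.le (-A) Y → f = 0) ∧
    t.le 0 ≤ ObjectProperty.extensionProduct
      (coprodClosure (shiftsOf G (Set.Icc (-A) A))).retractClosure (t.le (-1))

/-- The t-structure `t` belongs to the preferred equivalence class: it is equivalent to the
t-structure with aisle `Coprod(G(-∞,0])`, for a compact generator `G`. -/
def IsPreferred (t : TStructure C) : Prop :=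
  ∃ G : C, IsCompactGenerator G ∧ ∃ N : ℤ, 0 < N ∧
    t.le (-N) ≤ coprodClosure (shiftsOf G (Set.Iic 0)) ∧
    coprodClosure (shiftsOf G (Set.Iic 0)) ≤ t.le N

/-- The subcategory `T^-_c` of pseudo-compact objects: those `F` which for each integer `m > 0`
admit a distinguished triangle `E ⟶ F ⟶ D ⟶ E⟦1⟧` with `E` compact and `D` in `T^{≤ -m}`. -/
def pseudoCompact (t : TStructure C) : ObjectProperty C :=
  fun F => ∀ m : ℤ, 0 < m →
    ObjectProperty.extensionProduct (compactObjects C) (t.le (-m)) F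

variable {D : Type u'} [Category.{v} D] [Preadditive D] [HasZeroObject D] [HasShift D ℤ]
  [∀ n : ℤ, (shiftFunctor D n).Additive] [Pretriangulated D]

/-- The triangulated functor `F : C ⥤ D` restricts to a triangulated equivalence from the full
triangulated subcategory `A` of `C` to the full triangulated subcategory `A'` of `D`. -/
def RestrictsToEquivalence (F : C ⥤ D) [F.CommShift ℤ] (A : ObjectProperty C)
    (A' : ObjectProperty D) : Prop :=
  ∃ (_ : A.IsTriangulated) (_ : A'.IsTriangulated)
    (h : ∀ X : A.FullSubcategory, A' ((A.ι ⋙ F).obj X)),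
    (A'.lift (A.ι ⋙ F) h).IsTriangulated ∧ (A'.lift (A.ι ⋙ F) h).IsEquivalence

end Triangulated

end WeakApprox

/-! Compactness of X means that every map from X to a coproduct is a finite sum of maps through
summands (`compactObjects_iff`). A telescope argument (`IsCompactGenerator.exists_eq_zero`) shows
that compact objects are bounded above. A coproduct existing in T^- is a coproduct in T, because its
summands are retracts of it and so uniformly bounded; hence compact objects of T are compact in T^-.
Conversely, a map from X in T^{≤m} to a coproduct in T factors through the coproduct of truncations
of the summands at a high level, which lies in T^- (`exists_truncLT_cofan`).

Each subcategory is then recognized inside its ambient category. In T^-, X is bounded iff for each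
compact K, Hom(K⟦i⟧, X) = 0 for i large; in T^+, iff for each Y, Hom(X⟦i⟧, Y) = 0 for i large. An
equivalence T^- → T'^- preserves compact objects, coproducts and triangles, so it sends the objects
of Coprod(G(-∞,0]) into some T'^{≤k} and moves aisles by a bounded amount
(`IsPreferred.exists_isLE_map`); hence it preserves T^-_c.

That T^-_c is triangulated rests on Hom(E, T^{≤M}) = 0 for E compact and some M
(`IsPreferred.exists_isLE_orthogonal`), obtained by approximating E repeatedly and applying the
telescope argument again. -/

namespace WeakApprox

section Cofans

variable {C : Type u} [Category.{v} C] {J : Type v}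

/-- The cofan attached to a cocone over a diagram of discrete shape. -/
def toCofan {K : Discrete J ⥤ C} (s : Cocone K) : Cofan (fun j ↦ K.obj ⟨j⟩) :=
  Cofan.mk s.pt fun j ↦ s.ι.app ⟨j⟩

/-- The cofan attached to a colimit cocone is a coproduct. -/
def isColimitToCofan {K : Discrete J ⥤ C} {s : Cocone K} (hs : IsColimit s) :
    IsColimit (toCofan s) :=
  Cofan.IsColimit.mk _
    (fun t ↦ hs.desc ⟨t.pt, Discrete.natTrans fun j ↦ t.inj j.as⟩)
    (fun _ j ↦ hs.fac _ ⟨j⟩)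
    (fun _ _ hm ↦ hs.hom_ext fun j ↦ by
      rw [hs.fac]
      exact hm j.as)

lemma isClosedUnderColimitsOfShape_discrete {S : ObjectProperty C}
    (h : ∀ (Y : J → C) (c : Cofan Y), IsColimit c → (∀ j, S (Y j)) → S c.pt) :
    S.IsClosedUnderColimitsOfShape (Discrete J) where
  colimitsOfShape_le := by
    rintro X ⟨p⟩
    exact h _ _ (isColimitToCofan p.isColimit) fun j ↦ p.prop_diag_obj ⟨j⟩

end Cofans

/-! ### Compactness as finiteness of maps into coproducts. -/

section Coproducts

variable {C : Type u} [Category.{v} C] [Preadditive C] {J : Type v} {Y : J → C} {c : Cofan Y}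

open Classical in
/-- The projection of a coproduct onto one of its summands. -/
noncomputable def cofanProj (hc : IsColimit c) (j : J) : c.pt ⟶ Y j :=
  Cofan.IsColimit.desc hc fun k ↦ if h : k = j then eqToHom (by rw [h]) else 0

@[simp]
lemma inj_cofanProj_self (hc : IsColimit c) (j : J) : c.inj j ≫ cofanProj hc j = 𝟙 _ := by
  simp [cofanProj]

lemma inj_cofanProj_of_ne (hc : IsColimit c) {j k : J} (h : k ≠ j) :
    c.inj k ≫ cofanProj hc j = 0 := by
  simp [cofanProj, h]

/-- The morphisms to a coproduct that are finite sums of morphisms to the summands. -/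
def finiteMaps (c : Cofan Y) (X : C) : AddSubgroup (X ⟶ c.pt) :=
  AddSubgroup.closure {f | ∃ (j : J) (g : X ⟶ Y j), f = g ≫ c.inj j}

lemma comp_inj_mem_finiteMaps (c : Cofan Y) {X : C} {j : J} (g : X ⟶ Y j) :
    g ≫ c.inj j ∈ finiteMaps c X :=
  AddSubgroup.subset_closure ⟨j, g, rfl⟩

lemma finiteMaps_le_iff (c : Cofan Y) {X : C} {S : AddSubgroup (X ⟶ c.pt)} :
    finiteMaps c X ≤ S ↔ ∀ (j : J) (g : X ⟶ Y j), g ≫ c.inj j ∈ S := by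
  rw [finiteMaps, AddSubgroup.closure_le]
  exact ⟨fun h j g ↦ h ⟨j, g, rfl⟩, by rintro h _ ⟨j, g, rfl⟩; exact h j g⟩

lemma comp_mem_finiteMaps {X X' : C} (a : X' ⟶ X) {f : X ⟶ c.pt} (hf : f ∈ finiteMaps c X) :
    a ≫ f ∈ finiteMaps c X' := by
  suffices finiteMaps c X ≤ (finiteMaps c X').comap (Preadditive.leftComp c.pt a) from this hf
  rw [finiteMaps_le_iff]
  intro j g
  change a ≫ g ≫ c.inj j ∈ finiteMaps c X'
  simpa using comp_inj_mem_finiteMaps c (a ≫ g)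

lemma exists_finset_of_mem_finiteMaps (hc : IsColimit c) {X : C} {f : X ⟶ c.pt}
    (hf : f ∈ finiteMaps c X) :
    ∃ s : Finset J, f = ∑ j ∈ s, (f ≫ cofanProj hc j) ≫ c.inj j ∧
      ∀ j ∉ s, f ≫ cofanProj hc j = 0 := by
  classical
  -- Allowing every larger index set lets the decompositions of two maps be compared over a common
  -- one.
  suffices ∃ s : Finset J, (∀ j ∉ s, f ≫ cofanProj hc j = 0) ∧
      ∀ t, s ⊆ t → f = ∑ j ∈ t, (f ≫ cofanProj hc j) ≫ c.inj j by
    obtain ⟨s, h, h'⟩ := this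
    exact ⟨s, h' s subset_rfl, h⟩
  induction hf using AddSubgroup.closure_induction with
  | mem f hf =>
    obtain ⟨j, g, rfl⟩ := hf
    have h (k : J) (hk : k ≠ j) : (g ≫ c.inj j) ≫ cofanProj hc k = 0 := by
      simp [inj_cofanProj_of_ne hc hk.symm]
    refine ⟨{j}, fun k hk ↦ h k (by simpa using hk), fun t ht ↦ ?_⟩
    rw [Finset.sum_eq_single j]
    · simp
    · intro k _ hk
      rw [h k hk, zero_comp]
    · intro hj
      exact (hj (ht (by simp))).elim
  | zero => exact ⟨∅, by simp, by simp⟩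
  | add f g _ _ hf hg =>
    obtain ⟨s, hs, hs'⟩ := hf
    obtain ⟨t, ht, ht'⟩ := hg
    refine ⟨s ∪ t, fun j hj ↦ ?_, fun r hr ↦ ?_⟩
    · simp only [Finset.mem_union, not_or] at hj
      rw [Preadditive.add_comp, hs j hj.1, ht j hj.2, add_zero]
    · conv_lhs => rw [hs' r (Finset.union_subset_left hr), ht' r (Finset.union_subset_right hr)]
      simp [Finset.sum_add_distrib]
  | neg f _ hf =>
    obtain ⟨s, hs, hs'⟩ := hf
    refine ⟨s, fun j hj ↦ by simp [hs j hj], fun t ht ↦ ?_⟩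
    conv_lhs => rw [hs' t ht]
    simp

/-- Projections need not detect arbitrary maps into a coproduct; they do detect finite sums. -/
lemma eq_zero_of_mem_finiteMaps (hc : IsColimit c) {X : C} {f : X ⟶ c.pt}
    (hf : f ∈ finiteMaps c X) (h : ∀ j, f ≫ cofanProj hc j = 0) : f = 0 := by
  obtain ⟨s, hs, -⟩ := exists_finset_of_mem_finiteMaps hc hf
  rw [hs]
  exact Finset.sum_eq_zero fun j _ ↦ by rw [h, zero_comp]

open Classical in
lemma compactObjects_iff (X : C) :
    compactObjects C X ↔ ∀ (J : Type v) (Y : J → C) (c : Cofan Y), IsColimit c →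
      ∀ f : X ⟶ c.pt, f ∈ finiteMaps c X := by
  constructor
  · intro h J Y c hc f
    have := h J
    let F := preadditiveCoyoneda.obj (Opposite.op X)
    have hc' := isColimitOfPreserves F hc
    -- The quotient map kills the image of each summand, so it is zero once Hom(X, -) preserves the
    -- coproduct.
    let Q := AddCommGrpCat.of ((X ⟶ c.pt) ⧸ finiteMaps c X)
    let q : F.obj c.pt ⟶ Q := AddCommGrpCat.ofHom (QuotientAddGroup.mk' (finiteMaps c X))
    have hq : q = 0 := by
      refine hc'.hom_ext fun ⟨j⟩ ↦ ?_
      ext g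
      exact (QuotientAddGroup.eq_zero_iff _).2 (comp_inj_mem_finiteMaps c (j := j) g)
    have := ConcreteCategory.congr_hom hq f
    exact (QuotientAddGroup.eq_zero_iff _).1 this
  · intro h J
    refine ⟨fun {K} ↦ ⟨fun {s} hs ↦ ⟨?_⟩⟩⟩
    let hc := isColimitToCofan hs
    let c := toCofan s
    let F := preadditiveCoyoneda.obj (Opposite.op X)
    have supp (f : X ⟶ c.pt) : {j | f ≫ cofanProj hc j ≠ 0}.Finite := by
      obtain ⟨t, -, ht⟩ := exists_finset_of_mem_finiteMaps hc (h _ _ _ hc f)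
      refine t.finite_toSet.subset fun j hj ↦ ?_
      by_contra hj'
      exact hj (ht j hj')
    let φ (r : Cocone (K ⋙ F)) (j : J) : (X ⟶ K.obj ⟨j⟩) →+ r.pt := (r.ι.app ⟨j⟩).hom
    have supp' (r : Cocone (K ⋙ F)) (f : X ⟶ c.pt) :
        (Function.support fun j ↦
          φ r j (f ≫ cofanProj hc j)).Finite := by
      refine (supp f).subset fun j hj ↦ ?_
      intro h0
      apply hj
      change φ r j (f ≫ cofanProj hc j) = 0
      rw [h0]
      exact map_zero (φ r _)
    let d (r : Cocone (K ⋙ F)) : (X ⟶ c.pt) →+ r.pt :=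
      { toFun := fun f ↦ ∑ᶠ j, φ r j (f ≫ cofanProj hc j)
        map_zero' := finsum_eq_zero_of_forall_eq_zero fun j ↦ by
          rw [zero_comp, map_zero]
        map_add' := fun f g ↦ by
          rw [← finsum_add_distrib (supp' r f) (supp' r g)]
          exact finsum_congr fun j ↦ by rw [Preadditive.add_comp, map_add] }
    have hd (r : Cocone (K ⋙ F)) (j : J) (g : X ⟶ K.obj ⟨j⟩) :
        d r (g ≫ c.inj j) = φ r j g := by
      change ∑ᶠ k, φ r k ((g ≫ c.inj j) ≫ cofanProj hc k) = _
      rw [finsum_eq_single _ j]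
      · simp
      · intro k hk
        rw [Category.assoc, inj_cofanProj_of_ne hc hk.symm, comp_zero, map_zero]
    refine ⟨fun r ↦ AddCommGrpCat.ofHom (d r), fun r ⟨j⟩ ↦ ?_, fun r m hm ↦ ?_⟩
    · ext g
      exact hd r j g
    · ext f
      let m' : (X ⟶ c.pt) →+ r.pt := m.hom
      suffices finiteMaps c X ≤ AddMonoidHom.eqLocus m' (d r) from this (h _ _ _ hc f)
      rw [finiteMaps_le_iff]
      intro j g
      exact (ConcreteCategory.congr_hom (hm ⟨j⟩) g).trans (hd r j g).symm

lemma compactObjects_of_retract {X X' : C} (r : Retract X X') (h : compactObjects C X') :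
    compactObjects C X := by
  rw [compactObjects_iff] at h ⊢
  intro J Y c hc f
  simpa using comp_mem_finiteMaps r.i (h J Y c hc (r.r ≫ f))

instance : (compactObjects C).IsStableUnderRetracts where
  of_retract := compactObjects_of_retract

lemma compactObjects_functor_obj {D : Type u'} [Category.{v} D] [Preadditive D] (e : C ≌ D)
    [e.functor.Additive] {X : C} (h : compactObjects C X) :
    compactObjects D (e.functor.obj X) := by
  rw [compactObjects_iff] at h ⊢
  intro J Y c hc f
  let c' : Cofan (fun j ↦ e.inverse.obj (Y j)) :=
    Cofan.mk (e.inverse.obj c.pt) fun j ↦ e.inverse.map (c.inj j)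
  have hc' : IsColimit c' :=
    Cofan.isColimitMapCoconeEquiv e.inverse Y c (isColimitOfPreserves e.inverse hc)
  let f' : X ⟶ c'.pt := e.unit.app X ≫ e.inverse.map f
  have hf : f = e.functor.map f' ≫ e.counit.app c.pt := by
    simp [f', c']
  suffices finiteMaps c' X ≤ (finiteMaps c (e.functor.obj X)).comap
      ((Preadditive.rightComp (e.functor.obj X) (e.counit.app c.pt)).comp
        e.functor.mapAddHom) by
    rw [hf]
    exact this (h _ _ _ hc' f')
  rw [finiteMaps_le_iff]
  intro j g
  have : e.functor.map (g ≫ c'.inj j) ≫ e.counit.app c.pt =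
      (e.functor.map g ≫ e.counit.app (Y j)) ≫ c.inj j := by
    simp [c']
  rw [AddSubgroup.mem_comap]
  change e.functor.map (g ≫ c'.inj j) ≫ e.counit.app c.pt ∈ _
  rw [this]
  exact comp_inj_mem_finiteMaps c _

lemma compactObjects_map {D : Type u'} [Category.{v} D] [Preadditive D] (F : C ⥤ D)
    [F.Additive] [F.IsEquivalence] {X : C} (h : compactObjects C X) :
    compactObjects D (F.obj X) :=
  have : F.asEquivalence.functor.Additive := inferInstanceAs F.Additive
  compactObjects_functor_obj F.asEquivalence h

lemma compactObjects_shift [HasShift C ℤ] [∀ n : ℤ, (shiftFunctor C n).Additive] {X : C}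
    (h : compactObjects C X) (n : ℤ) : compactObjects C (X⟦n⟧) :=
  compactObjects_map (shiftFunctor C n) h

end Coproducts

/-! ### Compact objects form a triangulated subcategory. -/

section Triangulated

variable {C : Type u} [Category.{v} C] [Preadditive C] [HasZeroObject C] [HasShift C ℤ]
  [∀ n : ℤ, (shiftFunctor C n).Additive] [Pretriangulated C]

instance : (compactObjects C).IsTriangulated where
  exists_zero := ⟨_, isZero_zero C, by
    rw [compactObjects_iff]
    intro J Y c hc f
    rw [(isZero_zero C).eq_of_src f 0]
    exact zero_mem _⟩
  isStableUnderShiftBy n := ⟨fun X h ↦ compactObjects_shift h n⟩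
  toIsTriangulatedClosed₂ := .mk' fun T hT h₁ h₃ ↦ by
    rw [compactObjects_iff] at h₁ h₃ ⊢
    intro J Y c hc f
    -- Only finitely many components of `f` survive on `T.obj₁`; after subtracting these, `f`
    -- factors through `T.obj₃`.
    obtain ⟨s, hs, -⟩ := exists_finset_of_mem_finiteMaps hc (h₁ J Y c hc (T.mor₁ ≫ f))
    obtain ⟨g, hg⟩ := T.yoneda_exact₂ hT
      (f - ∑ j ∈ s, (f ≫ cofanProj hc j) ≫ c.inj j) (by
        rw [Preadditive.comp_sub, Preadditive.comp_sum, sub_eq_zero]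
        simpa using hs)
    rw [sub_eq_iff_eq_add] at hg
    rw [hg]
    exact add_mem (comp_mem_finiteMaps _ (h₃ J Y c hc g))
      (sum_mem fun j _ ↦ comp_inj_mem_finiteMaps c _)

end Triangulated

section Preadditive

variable {C : Type u} [Category.{v} C] [Preadditive C]

lemma eq_zero_of_iso {X X' Y Y' : C} (e : X ≅ X') (e' : Y ≅ Y')
    (h : ∀ f : X' ⟶ Y', f = 0) (f : X ⟶ Y) : f = 0 := by
  rw [← cancel_epi e.inv, ← cancel_mono e'.hom, h ((e.inv ≫ f) ≫ e'.hom)]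
  simp

lemma eq_zero_of_forall_shift [HasShift C ℤ] [∀ n : ℤ, (shiftFunctor C n).Additive] {X Y : C}
    (a : ℤ) (h : ∀ f : X⟦a⟧ ⟶ Y⟦a⟧, f = 0) (f : X ⟶ Y) : f = 0 :=
  (shiftFunctor C a).map_injective (by rw [h (f⟦a⟧'), Functor.map_zero])

end Preadditive

/-! ### Telescopes, aisles and boundedness of compact objects. -/

section Triangulated

variable {C : Type u} [Category.{v} C] [Preadditive C] [HasZeroObject C] [HasShift C ℤ]
  [∀ n : ℤ, (shiftFunctor C n).Additive] [Pretriangulated C]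

/-- If `Hom(K, -)` is surjective and `Hom(K⟦-1⟧, -)` is injective on the first morphism of a
distinguished triangle, then the third object receives no nonzero morphism from `K`. -/
lemma hom_obj₃_eq_zero {T : Triangle C} (hT : T ∈ distTriang C) {K K' : C} (e : K'⟦(1 : ℤ)⟧ ≅ K)
    (hs : ∀ f : K ⟶ T.obj₂, ∃ g : K ⟶ T.obj₁, g ≫ T.mor₁ = f)
    (hi : ∀ g : K' ⟶ T.obj₁, g ≫ T.mor₁ = 0 → g = 0) (h : K ⟶ T.obj₃) : h = 0 := by
  obtain ⟨k, hk⟩ := (shiftFunctor C (1 : ℤ)).map_surjective (e.hom ≫ h ≫ T.mor₃)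
  have hk' : k = 0 := hi k ((shiftFunctor C (1 : ℤ)).map_injective (by
    simp [hk, comp_distTriang_mor_zero₃₁ _ hT]))
  have h₃ : h ≫ T.mor₃ = 0 := by
    rw [← cancel_epi e.hom, ← hk, hk', Functor.map_zero, comp_zero]
  obtain ⟨f, rfl⟩ := T.coyoneda_exact₃ hT h h₃
  obtain ⟨g, rfl⟩ := hs f
  simp [comp_distTriang_mor_zero₁₂ _ hT]

/-- The isomorphism `G⟦i - 1⟧⟦1⟧ ≅ G⟦i⟧`. -/
noncomputable def shiftPredShiftIso (G : C) (i : ℤ) : (G⟦i - 1⟧)⟦(1 : ℤ)⟧ ≅ G⟦i⟧ :=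
  ((shiftFunctorAdd' C (i - 1) 1 i (by lia)).app G).symm

lemma IsCompactGenerator.isIso {G : C} (hG : IsCompactGenerator G) {X Y : C} (f : X ⟶ Y)
    (hs : ∀ (i : ℤ) (h : G⟦i⟧ ⟶ Y), ∃ g : G⟦i⟧ ⟶ X, g ≫ f = h)
    (hi : ∀ (i : ℤ) (g : G⟦i⟧ ⟶ X), g ≫ f = 0 → g = 0) : IsIso f := by
  obtain ⟨Z, g, h, hT⟩ := distinguished_cocone_triangle f
  exact (Triangle.isZero₃_iff_isIso₁ _ hT).1 (hG.2 Z fun i ↦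
    hom_obj₃_eq_zero hT (shiftPredShiftIso G i) (hs i) (hi (i - 1)))

/-- Let `G` be a compact generator, and let `X 0 ⟶ X 1 ⟶ ⋯` be a sequence such that each shift
of `G` has no nonzero morphism to all but finitely many of the objects `X n`. Then a morphism from
a compact object to `X 0` becomes zero in some `X n`. -/
lemma IsCompactGenerator.exists_eq_zero [HasCoproducts.{v} C] {G : C} (hG : IsCompactGenerator G)
    {E : C} (hE : compactObjects C E) (X : ℕ → C) (τ : ∀ n, X n ⟶ X (n + 1))
    (hX : ∀ i : ℤ, ∃ n₀, ∀ n, n₀ ≤ n → ∀ f : G⟦i⟧ ⟶ X n, f = 0)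
    (p : ∀ n, E ⟶ X n) (hp : ∀ n, p n ≫ τ n = p (n + 1)) : ∃ n, p n = 0 := by
  let Y : ULift.{v} ℕ → C := fun n ↦ X n.down
  let c : Cofan Y := Cofan.mk (∐ Y) (Sigma.ι Y)
  have hc : IsColimit c := coproductIsCoproduct Y
  let ι (n : ℕ) : X n ⟶ c.pt := c.inj ⟨n⟩
  let π (n : ℕ) : c.pt ⟶ X n := cofanProj hc ⟨n⟩
  have ι_π (n : ℕ) : ι n ≫ π n = 𝟙 _ := inj_cofanProj_self hc _
  have ι_π' (m n : ℕ) (h : m ≠ n) : ι m ≫ π n = 0 :=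
    inj_cofanProj_of_ne hc (by simpa [ULift.ext_iff] using h)
  have hom_ext {Z : C} {a b : c.pt ⟶ Z} (h : ∀ n, ι n ≫ a = ι n ≫ b) : a = b :=
    Cofan.IsColimit.hom_ext hc _ _ fun n ↦ h n.down
  let s : c.pt ⟶ c.pt := Cofan.IsColimit.desc hc fun n ↦ τ n.down ≫ ι (n.down + 1)
  have ι_s (n : ℕ) : ι n ≫ s = τ n ≫ ι (n + 1) :=
    Cofan.IsColimit.fac hc (fun n ↦ τ n.down ≫ ι (n.down + 1)) ⟨n⟩
  have s_π_zero : s ≫ π 0 = 0 := hom_ext fun n ↦ by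
    rw [← Category.assoc, ι_s, Category.assoc, ι_π' _ _ (by simp), comp_zero, comp_zero]
  have s_π_succ (n : ℕ) : s ≫ π (n + 1) = π n ≫ τ n := hom_ext fun m ↦ by
    rw [← Category.assoc, ι_s, Category.assoc, ← Category.assoc (ι m)]
    obtain rfl | h := eq_or_ne m n
    · simp [ι_π]
    · rw [ι_π' _ _ h, ι_π' _ _ (by simpa using h), zero_comp, comp_zero]
  have finite {K : C} (hK : compactObjects C K) (f : K ⟶ c.pt) : f ∈ finiteMaps c K :=
    (compactObjects_iff K).1 hK _ _ _ hc f
  -- Equivalently, the homotopy colimit of the sequence vanishes.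
  have : IsIso (𝟙 c.pt - s) := by
    refine hG.isIso _ (fun i h ↦ ?_) (fun i g hg ↦ ?_)
    · obtain ⟨n₀, hn₀⟩ := hX i
      -- Descending induction on `n`: modulo the image of `𝟙 - s`, a map to `X n` may be pushed to
      -- `X (n + 1)`, and it dies from `n₀` on.
      have key (k : ℕ) : ∀ n, n₀ ≤ n + k → ∀ g : G⟦i⟧ ⟶ X n,
          ∃ g' : G⟦i⟧ ⟶ c.pt, g' ≫ (𝟙 c.pt - s) = g ≫ ι n := by
        induction k with
        | zero =>
          intro n hn g
          exact ⟨0, by rw [hn₀ n (by simpa using hn) g]; simp⟩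
        | succ k hk =>
          intro n hn g
          obtain ⟨g', hg'⟩ := hk (n + 1) (by lia) (g ≫ τ n)
          refine ⟨g' + g ≫ ι n, ?_⟩
          rw [Preadditive.add_comp, hg', Preadditive.comp_sub, Category.comp_id,
            Category.assoc, Category.assoc, ι_s]
          abel
      suffices finiteMaps c (G⟦i⟧) ≤ (Preadditive.rightComp (G⟦i⟧) (𝟙 c.pt - s)).range from
        this (finite (compactObjects_shift hG.1 i) h)
      rw [finiteMaps_le_iff]
      intro n g
      exact key n₀ n.down (by lia) g
    · rw [Preadditive.comp_sub, Category.comp_id, sub_eq_zero] at hg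
      have hπ (n : ℕ) : g ≫ π n = 0 := by
        induction n with
        | zero => rw [hg, Category.assoc, s_π_zero, comp_zero]
        | succ n hn => rw [hg, Category.assoc, s_π_succ, ← Category.assoc, hn, zero_comp]
      exact eq_zero_of_mem_finiteMaps hc (finite (compactObjects_shift hG.1 i) g) fun n ↦ hπ n.down
  -- Formally the inverse is the geometric series in `s`, so the components of `f` are the `p n`;
  -- compactness of `E` leaves finitely many nonzero.
  let f : E ⟶ c.pt := p 0 ≫ ι 0 ≫ inv (𝟙 c.pt - s)
  have hf : f = p 0 ≫ ι 0 + f ≫ s := by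
    have : f ≫ (𝟙 c.pt - s) = p 0 ≫ ι 0 := by
      simp only [f, Category.assoc, IsIso.inv_hom_id, Category.comp_id]
    rw [← this, Preadditive.comp_sub, Category.comp_id, sub_add_cancel]
  have hfπ (n : ℕ) : f ≫ π n = p n := by
    induction n with
    | zero => rw [hf]; simp [s_π_zero, ι_π]
    | succ n hn =>
      rw [hf, Preadditive.add_comp, Category.assoc, Category.assoc, s_π_succ,
        ι_π' _ _ (by simp), comp_zero, zero_add, ← Category.assoc, hn, hp]
  obtain ⟨t, -, ht⟩ := exists_finset_of_mem_finiteMaps hc (finite hE f)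
  obtain ⟨n, hn⟩ := Infinite.exists_notMem_finset t
  exact ⟨n.down, by rw [← hfπ]; exact ht n hn⟩

lemma coprodClosure_le {P S : ObjectProperty C} (h : P ≤ S)
    (h₂ : ∀ T ∈ distTriang C, S T.obj₁ → S T.obj₃ → S T.obj₂)
    (h₃ : ∀ (J : Type v) (Y : J → C) (c : Cofan Y), IsColimit c → (∀ j, S (Y j)) → S c.pt) :
    coprodClosure P ≤ S :=
  fun _ hX ↦ hX S h (fun _ ⟨_, _, _, _, _, hT, h, h'⟩ ↦ h₂ _ hT h h')
    fun J ↦ isClosedUnderColimitsOfShape_discrete (h₃ J)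

/-- Left orthogonals are closed under extensions and coproducts, so vanishing need only be tested on
the objects of `P`. -/
lemma coprodClosure_le_leftOrthogonal {P Q : ObjectProperty C} (h : P ≤ Q.leftOrthogonal) :
    coprodClosure P ≤ Q.leftOrthogonal := by
  refine coprodClosure_le h (fun T hT h₁ h₃ Y f hY ↦ ?_) (fun J Y c hc h Z f hZ ↦ ?_)
  · obtain ⟨g, rfl⟩ := T.yoneda_exact₂ hT f (h₁ _ hY)
    rw [h₃ g hY, comp_zero]
  · exact Cofan.IsColimit.hom_ext hc _ _ fun j ↦ by rw [h j (c.inj j ≫ f) hZ, comp_zero]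

lemma le_eq_leftOrthogonal (t : TStructure C) (n : ℤ) : t.le n = (t.ge (n + 1)).leftOrthogonal := by
  ext X
  rw [t.le_iff_isLE, t.isLE_iff_orthogonal n (n + 1) rfl]
  exact ⟨fun h Y f hY ↦ h Y f ⟨hY⟩, fun h Y f hY ↦ h f hY.ge⟩

lemma isLE_cofan (t : TStructure C) (n : ℤ) {J : Type v} {Y : J → C} {c : Cofan Y}
    (hc : IsColimit c) (h : ∀ j, t.IsLE (Y j) n) : t.IsLE c.pt n := by
  rw [t.isLE_iff_orthogonal n (n + 1) rfl]
  intro Z f _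
  exact Cofan.IsColimit.hom_ext hc _ _ fun j ↦ by
    rw [t.zero (c.inj j ≫ f) n (n + 1), comp_zero]

lemma coprodClosure_shiftsOf_le {t : TStructure C} {G : C} {n : ℤ} (hG : t.IsLE G n) :
    coprodClosure (shiftsOf G (Set.Iic 0)) ≤ t.le n := by
  rw [le_eq_leftOrthogonal]
  refine coprodClosure_le_leftOrthogonal ?_
  rw [← le_eq_leftOrthogonal]
  rintro X ⟨i, hi, ⟨e⟩⟩
  have : 0 ≤ i := by simpa using hi
  have := t.isLE_shift G n i (n - i)
  have := t.isLE_of_le (G⟦i⟧) (n - i) n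
  exact (t.isLE_of_iso e.symm n).le

lemma shiftsOf_le_coprodClosure {G : C} {s : Set ℤ} (h : 0 ∈ s) :
    coprodClosure (shiftsOf G s) G :=
  fun _ hS _ _ ↦ hS _ ⟨0, by simpa using h, ⟨((shiftFunctorZero C ℤ).app G).symm⟩⟩

/-- The compact objects are bounded above for a t-structure such that some compact generator
is bounded above. -/
lemma IsCompactGenerator.compactObjects_le_minus [HasCoproducts.{v} C] {G : C}
    (hG : IsCompactGenerator G) {t : TStructure C} (h : t.minus G) :
    compactObjects C ≤ t.minus := by
  intro E hE
  obtain ⟨m, _⟩ := h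
  obtain ⟨n, hn⟩ := hG.exists_eq_zero hE (fun n : ℕ ↦ (t.truncGE n).obj E)
    (fun n ↦ (t.natTransTruncGEOfLE n (n + 1 : ℕ) (by lia)).app E)
    (fun i ↦ ⟨(m - i + 1).toNat, fun n hn f ↦ by
      have := t.isLE_shift G m i (m - i)
      exact t.zero f (m - i) n⟩)
    (fun n ↦ (t.truncGEπ n).app E) (fun n ↦ by simp)
  refine ⟨n - 1, (t.isLE_iff_orthogonal (n - 1) n (by lia) E).2 fun Y f hY ↦ ?_⟩
  -- Maps to coconnective objects factor through the truncation, whose projection vanishes.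
  rw [← t.π_descTruncGE f n, hn, zero_comp]

end Triangulated

/-! ### Coproducts in full subcategories. -/

section FullSubcategory

variable {C : Type u} [Category.{v} C] {P : ObjectProperty C} {J : Type v}
  {Y : J → P.FullSubcategory}

/-- The image of a cofan in a full subcategory. -/
def cofanι (c : Cofan Y) : Cofan fun j ↦ (Y j).obj :=
  Cofan.mk c.pt.obj fun j ↦ (c.inj j).hom

/-- A cofan of objects of a full subcategory whose point is in the subcategory. -/
def cofanLift (c : Cofan fun j ↦ (Y j).obj) (h : P c.pt) : Cofan Y :=
  Cofan.mk ⟨c.pt, h⟩ fun j ↦ ObjectProperty.homMk (c.inj j)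

/-- A coproduct whose summands and point are in a full subcategory is a coproduct in the
full subcategory. -/
noncomputable def isColimitCofanLift {c : Cofan fun j ↦ (Y j).obj} (hc : IsColimit c)
    (h : P c.pt) : IsColimit (cofanLift c h) :=
  Cofan.IsColimit.mk _
    (fun t ↦ ObjectProperty.homMk (Cofan.IsColimit.desc hc fun j ↦ (t.inj j).hom))
    (fun t j ↦ by
      ext
      exact Cofan.IsColimit.fac hc (fun j ↦ (t.inj j).hom) j)
    (fun t m hm ↦ by
      ext
      refine Cofan.IsColimit.hom_ext hc _ _ fun j ↦ ?_
      refine Eq.trans ?_ (Cofan.IsColimit.fac hc (fun j ↦ (t.inj j).hom) j).symm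
      exact congr_arg (·.hom) (hm j))

/-- If the ambient coproduct lies in the subcategory, uniqueness identifies it with `c`. -/
lemma nonempty_isColimit_cofanι {c : Cofan Y} (hc : IsColimit c)
    {d : Cofan fun j ↦ (Y j).obj} (hd : IsColimit d) (h : P d.pt) :
    Nonempty (IsColimit (cofanι c)) := by
  let e := hc.coconePointUniqueUpToIso (isColimitCofanLift hd h)
  refine ⟨hd.ofIsoColimit (Cofan.ext (P.ι.mapIso e.symm) fun j ↦ ?_)⟩
  exact congr_arg (·.hom)
    (hc.comp_coconePointUniqueUpToIso_inv (isColimitCofanLift hd h) ⟨j⟩)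

lemma hom_mem_finiteMaps_iff [Preadditive C] (c : Cofan Y) {X : P.FullSubcategory}
    (f : X ⟶ c.pt) : f.hom ∈ finiteMaps (cofanι c) X.obj ↔ f ∈ finiteMaps c X := by
  let φ : (X ⟶ c.pt) →+ (X.obj ⟶ c.pt.obj) := P.ι.mapAddHom
  constructor
  · intro hf
    suffices finiteMaps (cofanι c) X.obj ≤ AddSubgroup.map (N := X.obj ⟶ (cofanι c).pt) φ
        (finiteMaps c X) by
      obtain ⟨g, hg, hg'⟩ := this hf
      obtain rfl : g = f := P.ι.map_injective hg'
      exact hg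
    rw [finiteMaps_le_iff]
    intro j g
    exact ⟨ObjectProperty.homMk g ≫ c.inj j, comp_inj_mem_finiteMaps _ _, rfl⟩
  · intro hf
    suffices finiteMaps c X ≤ (finiteMaps (cofanι c) X.obj).comap φ from this hf
    rw [finiteMaps_le_iff]
    intro j g
    exact comp_inj_mem_finiteMaps (cofanι c) g.hom

end FullSubcategory

/-- All shifts `X⟦i⟧` with `i` large have no nonzero morphism to `Y`. -/
def EventuallyZero {C : Type u} [Category.{v} C] [Preadditive C] [HasShift C ℤ] (X Y : C) :
    Prop :=
  ∃ n : ℤ, ∀ i, n ≤ i → ∀ f : X⟦i⟧ ⟶ Y, f = 0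

/-! ### Preferred t-structures, and compactness in T^- versus T. -/

section Triangulated

variable {C : Type u} [Category.{v} C] [Preadditive C] [HasZeroObject C] [HasShift C ℤ]
  [∀ n : ℤ, (shiftFunctor C n).Additive] [Pretriangulated C] {t : TStructure C} {G : C} {N : ℤ}

lemma eventuallyZero_of_isLE_of_isGE {X Y : C} (hX : t.minus X) (hY : t.plus Y) :
    EventuallyZero X Y := by
  obtain ⟨a, _⟩ := hX
  obtain ⟨b, _⟩ := hY
  refine ⟨a - b + 1, fun i hi f ↦ ?_⟩
  have := t.isLE_shift X a i (a - i)
  exact t.zero f (a - i) b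

lemma IsPreferred.exists_generator (ht : IsPreferred t) :
    ∃ (G : C) (N : ℤ), IsCompactGenerator G ∧ t.IsLE G N ∧
      t.le (-N) ≤ coprodClosure (shiftsOf G (Set.Iic 0)) := by
  obtain ⟨G, hG, N, -, h, h'⟩ := ht
  exact ⟨G, N, hG, ⟨h' _ (shiftsOf_le_coprodClosure (by simp))⟩, h⟩

/-- The vanishing makes `X⟦-n⟧` right orthogonal to Coprod(G(-∞,0]), hence to T^{≤-N}; undoing the
shift gives the bound. -/
lemma isGE_of_forall_shift (h : t.le (-N) ≤ coprodClosure (shiftsOf G (Set.Iic 0)))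
    {X : C} {n : ℤ} (hX : ∀ i, n ≤ i → ∀ f : G⟦i⟧ ⟶ X, f = 0) : t.IsGE X (1 - N - n) := by
  rw [t.isGE_iff_orthogonal (-N - n) (1 - N - n) (by lia)]
  intro Y f _
  refine eq_zero_of_forall_shift (-n) (fun f ↦ ?_) f
  have := t.isLE_shift Y (-N - n) (-n) (-N)
  suffices shiftsOf G (Set.Iic 0) ≤ (ObjectProperty.singleton (X⟦-n⟧)).leftOrthogonal from
    coprodClosure_le_leftOrthogonal this _ (h _ (t.le_of_isLE _ _)) f ⟨⟨⟩⟩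
  rintro Z ⟨i, hi, ⟨e⟩⟩ _ g ⟨⟨⟩⟩
  have hi : 0 ≤ i := by simpa using hi
  exact eq_zero_of_iso e (Iso.refl _) (eq_zero_of_forall_shift n
    (eq_zero_of_iso ((shiftFunctorAdd' C i n (i + n) rfl).symm.app G)
      (shiftNegShift X n) (hX (i + n) (by lia)))) g

lemma plus_iff_eventuallyZero (hG : t.IsLE G N)
    (h : t.le (-N) ≤ coprodClosure (shiftsOf G (Set.Iic 0))) (X : C) :
    t.plus X ↔ EventuallyZero G X := by
  refine ⟨fun hX ↦ eventuallyZero_of_isLE_of_isGE ⟨N, hG⟩ hX, ?_⟩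
  rintro ⟨n, hn⟩
  exact ⟨_, isGE_of_forall_shift h hn⟩

lemma IsPreferred.compactObjects_le_minus [HasCoproducts.{v} C] (ht : IsPreferred t) :
    compactObjects C ≤ t.minus := by
  obtain ⟨G, N, hG, hN, -⟩ := ht.exists_generator
  exact hG.compactObjects_le_minus ⟨N, hN⟩

lemma shift_generator_eq_zero (hG : t.IsLE G N) {X : C} {m i : ℤ} (hX : t.IsGE X m)
    (hi : N < i + m) (f : G⟦i⟧ ⟶ X) : f = 0 := by
  have := t.isLE_shift G N i (N - i)
  exact t.zero f (N - i) m

/-- Shifts of a compact generator see a coproduct through its summands, and the common bound `m`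
gives a common range of vanishing. -/
lemma IsPreferred.plus_cofan (ht : IsPreferred t) (m : ℤ) {J : Type v} {Y : J → C} {c : Cofan Y}
    (hc : IsColimit c) (h : ∀ j, t.IsGE (Y j) m) : t.plus c.pt := by
  obtain ⟨G, N, hG, hN, hle⟩ := ht.exists_generator
  rw [plus_iff_eventuallyZero hN hle]
  refine ⟨N - m + 1, fun i hi f ↦ ?_⟩
  exact eq_zero_of_mem_finiteMaps hc
    ((compactObjects_iff _).1 (compactObjects_shift hG.1 i) _ _ _ hc f)
    fun j ↦ shift_generator_eq_zero hN (h j) (by lia) _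

lemma exists_lift_truncLT (hG : t.IsLE G N) {M i : ℤ} (hi : N < i + M) {Y : C} (g : G⟦i⟧ ⟶ Y) :
    ∃ g' : G⟦i⟧ ⟶ (t.truncLT M).obj Y, g' ≫ (t.truncLTι M).app Y = g := by
  obtain ⟨g', hg'⟩ := Triangle.coyoneda_exact₂ _ (t.triangleLTGE_distinguished M Y) g
    (shift_generator_eq_zero hG (inferInstanceAs (t.IsGE ((t.truncGE M).obj Y) M)) hi _)
  exact ⟨g', hg'.symm⟩

/-- The obstruction is a map to the truncation shifted by -1, which lies in T^{≥M+1}; so equality is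
allowed in `hi`, as needed at `i - 1` in the next lemma. -/
lemma eq_zero_of_comp_truncLTι (hG : t.IsLE G N) {M i : ℤ} (hi : N ≤ i + M) {Y : C}
    (g : G⟦i⟧ ⟶ (t.truncLT M).obj Y) (hg : g ≫ (t.truncLTι M).app Y = 0) : g = 0 := by
  obtain ⟨g', hg'⟩ := Triangle.coyoneda_exact₂ _
    (inv_rot_of_distTriang _ (t.triangleLTGE_distinguished M Y)) g hg
  have h : g' = 0 := shift_generator_eq_zero (m := M + 1) hG
    (t.isGE_shift ((t.truncGE M).obj Y) M (-1) (M + 1)) (by lia) g'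
  rw [h, zero_comp] at hg'
  exact hg'

/-- For a t-structure in the preferred equivalence class, the cone of the map from a coproduct
of truncations to the coproduct is bounded below. -/
lemma exists_truncLT_cofan (hG : compactObjects C G) (hN : t.IsLE G N)
    (hle : t.le (-N) ≤ coprodClosure (shiftsOf G (Set.Iic 0))) (M : ℤ)
    {J : Type v} {Y : J → C} {c : Cofan Y} (hc : IsColimit c)
    {d : Cofan fun j ↦ (t.truncLT M).obj (Y j)} (hd : IsColimit d) :
    ∃ (Z : C) (a : d.pt ⟶ c.pt) (b : c.pt ⟶ Z) (k : Z ⟶ d.pt⟦(1 : ℤ)⟧),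
      Triangle.mk a b k ∈ distTriang C ∧ t.IsGE Z (M - 2 * N) ∧
      ∀ j, d.inj j ≫ a = (t.truncLTι M).app (Y j) ≫ c.inj j := by
  let a : d.pt ⟶ c.pt := Cofan.IsColimit.desc hd fun j ↦ (t.truncLTι M).app (Y j) ≫ c.inj j
  have ha (j : J) : d.inj j ≫ a = (t.truncLTι M).app (Y j) ≫ c.inj j :=
    Cofan.IsColimit.fac hd (fun j ↦ (t.truncLTι M).app (Y j) ≫ c.inj j) j
  have ha' (j : J) : a ≫ cofanProj hc j = cofanProj hd j ≫ (t.truncLTι M).app (Y j) := by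
    refine Cofan.IsColimit.hom_ext hd _ _ fun k ↦ ?_
    rw [← Category.assoc, ha, Category.assoc, ← Category.assoc (d.inj k)]
    obtain rfl | h := eq_or_ne k j
    · simp
    · rw [inj_cofanProj_of_ne hc h, inj_cofanProj_of_ne hd h, comp_zero, zero_comp]
  obtain ⟨Z, b, k, hT⟩ := distinguished_cocone_triangle a
  refine ⟨Z, a, b, k, hT, ?_, ha⟩
  have key (i : ℤ) (hi : N + 1 - M ≤ i) : ∀ f : G⟦i⟧ ⟶ Z, f = 0 := by
    have fin (i : ℤ) := (compactObjects_iff _).1 (compactObjects_shift hG i)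
    have hs (f : G⟦i⟧ ⟶ c.pt) : ∃ g : G⟦i⟧ ⟶ d.pt, g ≫ a = f := by
      suffices finiteMaps c (G⟦i⟧) ≤ (Preadditive.rightComp (G⟦i⟧) a).range from
        this (fin i _ _ _ hc f)
      rw [finiteMaps_le_iff]
      intro j g
      obtain ⟨g', hg'⟩ := exists_lift_truncLT hN (M := M) (by lia) g
      refine ⟨g' ≫ d.inj j, ?_⟩
      change (g' ≫ d.inj j) ≫ a = g ≫ c.inj j
      rw [Category.assoc, ha, ← hg', Category.assoc]
    have hi (g : G⟦i - 1⟧ ⟶ d.pt) (hg : g ≫ a = 0) : g = 0 := by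
      refine eq_zero_of_mem_finiteMaps hd (fin (i - 1) _ _ _ hd g) fun j ↦ ?_
      refine eq_zero_of_comp_truncLTι hN (M := M) (by lia) _ ?_
      rw [Category.assoc, ← ha', ← Category.assoc, hg, zero_comp]
    exact hom_obj₃_eq_zero hT (shiftPredShiftIso G i) hs hi
  have := isGE_of_forall_shift hle key
  exact t.isGE_of_ge Z _ (1 - N - (N + 1 - M))

variable [HasCoproducts.{v} C]

/-- Each summand is a retract of `c.pt` and inherits its upper bound, so the coproduct taken in the
ambient category is bounded above too. -/
lemma isColimit_cofanι_minus {J : Type v} {Y : J → t.minus.FullSubcategory} {c : Cofan Y}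
    (hc : IsColimit c) : Nonempty (IsColimit (cofanι c)) := by
  obtain ⟨n, _⟩ := c.pt.property
  refine nonempty_isColimit_cofanι hc (coproductIsCoproduct _) ⟨n, ?_⟩
  refine isLE_cofan t n (coproductIsCoproduct _) fun j ↦ ?_
  rw [t.isLE_iff_orthogonal n (n + 1) rfl]
  intro Z f _
  have h₁ : (c.inj j).hom ≫ (cofanProj hc j).hom = 𝟙 _ :=
    congr_arg (·.hom) (inj_cofanProj_self hc j)
  rw [← Category.id_comp f, ← h₁, Category.assoc,
    t.zero ((cofanProj hc j).hom ≫ f) n (n + 1), comp_zero]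

lemma IsPreferred.compactObjects_iff (ht : IsPreferred t) (X : C) :
    compactObjects C X ↔
      ∃ h : t.minus X, compactObjects t.minus.FullSubcategory ⟨X, h⟩ := by
  constructor
  · intro hX
    refine ⟨ht.compactObjects_le_minus X hX, ?_⟩
    rw [WeakApprox.compactObjects_iff] at hX ⊢
    intro J Y c hc f
    obtain ⟨hc'⟩ := isColimit_cofanι_minus hc
    exact (hom_mem_finiteMaps_iff c f).1 (hX _ _ _ hc' f.hom)
  · rintro ⟨⟨m, _⟩, hX⟩
    rw [WeakApprox.compactObjects_iff] at hX ⊢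
    intro J Y c hc f
    obtain ⟨G, N, hG, hN, hle⟩ := ht.exists_generator
    -- The level puts the cone `Z` in T^{≥m+1}, which receives no nonzero map from `X`.
    let A (j : J) : C := (t.truncLT (m + 1 + 2 * N)).obj (Y j)
    let d : Cofan A := Cofan.mk (∐ A) (Sigma.ι A)
    have hd : IsColimit d := coproductIsCoproduct A
    obtain ⟨Z, a, b, k, hT, _, ha⟩ := exists_truncLT_cofan hG.1 hN hle (m + 1 + 2 * N) hc hd
    have hA (j : J) : t.IsLE (A j) (m + 2 * N) := t.isLE_truncLT_obj _ _ _
    have hfb : f ≫ b = 0 := t.zero _ m (m + 1 + 2 * N - 2 * N)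
    obtain ⟨g, hg⟩ : ∃ g : X ⟶ d.pt, f = g ≫ a := Triangle.coyoneda_exact₂ _ hT f hfb
    subst hg
    let A' (j : J) : t.minus.FullSubcategory := ⟨A j, m + 2 * N, hA j⟩
    let d' : Cofan A' := cofanLift (Y := A') d ⟨m + 2 * N, isLE_cofan t _ hd hA⟩
    have hg : g ∈ finiteMaps d X := (hom_mem_finiteMaps_iff d' _).2
      (hX J A' d' (isColimitCofanLift hd _) (ObjectProperty.homMk g))
    suffices finiteMaps d X ≤ (finiteMaps c X).comap (Preadditive.rightComp X a) from this hg
    rw [finiteMaps_le_iff]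
    intro j g
    change (g ≫ d.inj j) ≫ a ∈ finiteMaps c X
    rw [Category.assoc, ha, ← Category.assoc]
    exact comp_inj_mem_finiteMaps c _

end Triangulated

/-! ### Transport of eventual vanishing along equivalences. -/

section EventuallyZero

variable {C : Type u} [Category.{v} C] [Preadditive C] [HasShift C ℤ]
  {D : Type u'} [Category.{v} D] [Preadditive D] [HasShift D ℤ]

lemma eventuallyZero_map_iff (F : C ⥤ D) [F.CommShift ℤ] [F.Full] [F.Faithful] [F.Additive]
    (X Y : C) : EventuallyZero (F.obj X) (F.obj Y) ↔ EventuallyZero X Y := by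
  refine exists_congr fun n ↦ forall₂_congr fun i _ ↦ ⟨fun h f ↦ ?_, fun h f ↦ ?_⟩
  · exact F.map_injective ((eq_zero_of_iso ((F.commShiftIso i).app X) (Iso.refl _) h _).trans
      (F.map_zero (X⟦i⟧) Y).symm)
  · refine eq_zero_of_iso ((F.commShiftIso i).symm.app X) (Iso.refl _) (fun g ↦ ?_) f
    obtain ⟨g, rfl⟩ := F.map_surjective g
    rw [h g, F.map_zero]

lemma EventuallyZero.of_iso {X X' Y : C} (h : EventuallyZero X Y) (e : X ≅ X') :
    EventuallyZero X' Y := by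
  obtain ⟨n, hn⟩ := h
  exact ⟨n, fun i hi ↦ eq_zero_of_iso ((shiftFunctor C i).mapIso e.symm) (Iso.refl _) (hn i hi)⟩

lemma forall_compact_eventuallyZero_map_iff (F : C ⥤ D) [F.CommShift ℤ] [F.IsEquivalence]
    [F.Additive] (X : C) :
    (∀ K, compactObjects D K → EventuallyZero K (F.obj X)) ↔
      ∀ K, compactObjects C K → EventuallyZero K X := by
  refine ⟨fun h K hK ↦ (eventuallyZero_map_iff F K X).1 (h _ (compactObjects_map F hK)),
    fun h K hK ↦ ?_⟩
  have : F.asEquivalence.functor.Additive := inferInstanceAs F.Additive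
  have : F.inv.Additive := F.asEquivalence.inverse_additive
  have := h _ (compactObjects_map F.inv hK)
  exact ((eventuallyZero_map_iff F _ X).2 this).of_iso (F.asEquivalence.counitIso.app K)

lemma forall_eventuallyZero_map_iff (F : C ⥤ D) [F.CommShift ℤ] [F.IsEquivalence]
    [F.Additive] (X : C) :
    (∀ Y, EventuallyZero (F.obj X) Y) ↔ ∀ Y, EventuallyZero X Y := by
  refine ⟨fun h Y ↦ (eventuallyZero_map_iff F X Y).1 (h _), fun h Y ↦ ?_⟩
  obtain ⟨n, hn⟩ := (eventuallyZero_map_iff F X _).2 (h (F.objPreimage Y))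
  exact ⟨n, fun i hi ↦ eq_zero_of_iso (Iso.refl _) (F.objObjPreimageIso Y).symm (hn i hi)⟩

end EventuallyZero

/-! ### Intrinsic descriptions of bounded objects, and boundedness of equivalences. -/

section Triangulated

variable {C : Type u} [Category.{v} C] [Preadditive C] [HasZeroObject C] [HasShift C ℤ]
  [∀ n : ℤ, (shiftFunctor C n).Additive] [Pretriangulated C] {P : ObjectProperty C}

/-- The inclusion commutes with shifts through a given isomorphism, by which the connecting map must
be corrected. -/
lemma exists_distTriang_fullSubcategory [P.IsTriangulated] {X₁ X₂ X₃ : P.FullSubcategory}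
    {f : X₁.obj ⟶ X₂.obj} {g : X₂.obj ⟶ X₃.obj} {h : X₃.obj ⟶ X₁.obj⟦(1 : ℤ)⟧}
    (hT : Triangle.mk f g h ∈ distTriang C) :
    ∃ δ : X₃ ⟶ X₁⟦(1 : ℤ)⟧,
      Triangle.mk (Y := X₂) (ObjectProperty.homMk f) (ObjectProperty.homMk g) δ ∈ distTriang _ := by
  let f' : X₁ ⟶ X₂ := ObjectProperty.homMk f
  let g' : X₂ ⟶ X₃ := ObjectProperty.homMk g
  let δ : X₃ ⟶ X₁⟦(1 : ℤ)⟧ :=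
    P.fullyFaithfulι.preimage (h ≫ (P.ι.commShiftIso (1 : ℤ)).inv.app X₁)
  have hδ : P.ι.map δ ≫ (P.ι.commShiftIso (1 : ℤ)).hom.app X₁ = h := by
    have : P.ι.map δ = h ≫ (P.ι.commShiftIso (1 : ℤ)).inv.app X₁ := P.fullyFaithfulι.map_preimage _
    rw [this, Category.assoc, Iso.inv_hom_id_app]
    exact Category.comp_id _
  refine ⟨δ, (P.ι.map_distinguished_iff (Triangle.mk f' g' δ)).1 ?_⟩
  refine isomorphic_distinguished _ hT _
    (Triangle.isoMk _ _ (Iso.refl _) (Iso.refl _) (Iso.refl _) ?_ ?_ ?_)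
  · exact (Category.comp_id _).trans (Category.id_comp _).symm
  · exact (Category.comp_id _).trans (Category.id_comp _).symm
  · refine Eq.trans ?_ (hδ.trans (Category.id_comp _).symm)
    exact (congr_arg (_ ≫ ·) ((shiftFunctor C (1 : ℤ)).map_id _)).trans (Category.comp_id _)

end Triangulated

section Triangulated

variable {C : Type u} [Category.{v} C] [Preadditive C] [HasZeroObject C] [HasShift C ℤ]
  [∀ n : ℤ, (shiftFunctor C n).Additive] [Pretriangulated C] [HasCoproducts.{v} C]
  {t : TStructure C}
  {D : Type u'} [Category.{v} D] [Preadditive D] [HasZeroObject D] [HasShift D ℤ]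
  [∀ n : ℤ, (shiftFunctor D n).Additive] [Pretriangulated D] [HasCoproducts.{v} D]
  {t' : TStructure D}

/-- Bounded objects among the bounded above ones are characterized by the vanishing of
morphisms from the shifts of the compact objects. -/
lemma IsPreferred.bounded_iff_of_minus (ht : IsPreferred t) (X : t.minus.FullSubcategory) :
    t.bounded X.obj ↔
      ∀ K, compactObjects t.minus.FullSubcategory K → EventuallyZero K X := by
  constructor
  · intro hX K _
    exact (eventuallyZero_map_iff t.minus.ι K X).1
      (eventuallyZero_of_isLE_of_isGE K.property hX.1)
  · intro h
    obtain ⟨G, N, hG, hN, hle⟩ := ht.exists_generator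
    obtain ⟨hG', hc⟩ := (ht.compactObjects_iff G).1 hG.1
    exact ⟨(plus_iff_eventuallyZero hN hle _).2
      ((eventuallyZero_map_iff t.minus.ι ⟨G, hG'⟩ X).2 (h _ hc)), X.property⟩

/-- Bounded objects among the bounded below ones are characterized by the vanishing of
morphisms from their shifts. -/
lemma IsPreferred.bounded_iff_of_plus (ht : IsPreferred t) (X : t.plus.FullSubcategory) :
    t.bounded X.obj ↔ ∀ Y, EventuallyZero X Y := by
  constructor
  · intro hX Y
    exact (eventuallyZero_map_iff t.plus.ι X Y).1
      (eventuallyZero_of_isLE_of_isGE hX.2 Y.property)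
  · intro h
    -- All these lie in T^{≥0}, so a single test object, their coproduct, detects all the truncation
    -- maps of `X` at once.
    let Y (n : ULift.{v} ℕ) : C := ((t.truncGE n.down).obj X.obj)⟦(n.down : ℤ)⟧
    let c : Cofan Y := Cofan.mk (∐ Y) (Sigma.ι Y)
    have hc : IsColimit c := coproductIsCoproduct Y
    have hc' : t.plus c.pt := ht.plus_cofan 0 hc fun n ↦
      t.isGE_shift _ n.down n.down 0 (by simp)
    obtain ⟨n, hn⟩ := (eventuallyZero_map_iff t.plus.ι X ⟨c.pt, hc'⟩).2 (h _)
    let m : ULift.{v} ℕ := ⟨n.toNat⟩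
    have h₁ : ((t.truncGEπ m.down).app X.obj)⟦(m.down : ℤ)⟧' ≫ c.inj m = 0 :=
      hn m.down (by dsimp [m]; lia) _
    have h₂ : (t.truncGEπ m.down).app X.obj = 0 := by
      refine (shiftFunctor C (m.down : ℤ)).map_injective ?_
      let φ : X.obj⟦(m.down : ℤ)⟧ ⟶ Y m := ((t.truncGEπ m.down).app X.obj)⟦(m.down : ℤ)⟧'
      have h₃ : φ = 0 := by
        rw [← Category.comp_id φ, ← inj_cofanProj_self hc m, ← Category.assoc, h₁, zero_comp]
      exact h₃.trans (Functor.map_zero _ _ _).symm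
    refine ⟨X.property, m.down - 1,
      (t.isLE_iff_orthogonal (m.down - 1) m.down (by lia) _).2 fun Z f _ ↦ ?_⟩
    rw [← t.π_descTruncGE f m.down, h₂, zero_comp]

/-- A triangulated equivalence between categories of bounded above objects is bounded above. -/
lemma IsPreferred.exists_isLE_map (ht : IsPreferred t)
    (F : t.minus.FullSubcategory ⥤ t'.minus.FullSubcategory) [F.CommShift ℤ] [F.IsTriangulated]
    [F.IsEquivalence] :
    ∃ K : ℤ, ∀ (n : ℤ) (X : t.minus.FullSubcategory), t.IsLE X.obj n →
      t'.IsLE (F.obj X).obj (n + K) := by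
  obtain ⟨G, N, hG, hN, hle⟩ := ht.exists_generator
  obtain ⟨hG', hc⟩ := (ht.compactObjects_iff G).1 hG.1
  obtain ⟨k, hk⟩ := (F.obj ⟨G, hG'⟩).property
  -- The first clause keeps the objects in T^-, where `F` is defined, throughout the closure
  -- argument.
  let S : ObjectProperty C := fun X ↦ t.IsLE X N ∧ ∀ h : t.minus X, t'.IsLE (F.obj ⟨X, h⟩).obj k
  have hS : coprodClosure (shiftsOf G (Set.Iic 0)) ≤ S := by
    refine coprodClosure_le ?_ ?_ ?_
    · rintro X ⟨i, hi, ⟨e⟩⟩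
      have hi : 0 ≤ i := by simpa using hi
      have := t.isLE_shift G N i (N - i)
      have := t.isLE_of_le (G⟦i⟧) (N - i) N
      refine ⟨t.isLE_of_iso e.symm N, fun h ↦ ?_⟩
      let e' : (⟨X, h⟩ : t.minus.FullSubcategory) ≅ (⟨G, hG'⟩ : t.minus.FullSubcategory)⟦i⟧ :=
        t.minus.fullyFaithfulι.preimageIso (e ≪≫ (t.minus.ι.commShiftIso i).symm.app ⟨G, hG'⟩)
      have := t'.isLE_shift (F.obj ⟨G, hG'⟩).obj k i (k - i)
      exact ⟨(t'.le k).prop_of_iso ((t'.minus.ι.commShiftIso i).symm.app _ ≪≫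
        t'.minus.ι.mapIso ((F.commShiftIso i).symm.app _ ≪≫ F.mapIso e'.symm))
        (t'.isLE_of_le ((F.obj ⟨G, hG'⟩).obj⟦i⟧) (k - i) k).le⟩
    · intro T hT h₁ h₃
      refine ⟨t.isLE₂ T hT N h₁.1 h₃.1, fun h ↦ ?_⟩
      obtain ⟨δ, hT'⟩ := exists_distTriang_fullSubcategory (P := t.minus)
        (X₁ := ⟨T.obj₁, N, h₁.1⟩) (X₂ := ⟨T.obj₂, h⟩) (X₃ := ⟨T.obj₃, N, h₃.1⟩) hT
      exact t'.isLE₂ _ (t'.minus.ι.map_distinguished _ (F.map_distinguished _ hT')) k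
        (h₁.2 _) (h₃.2 _)
    · intro J Y c hc h
      have hcN := isLE_cofan t N hc fun j ↦ (h j).1
      refine ⟨hcN, fun h' ↦ ?_⟩
      let Y' (j : J) : t.minus.FullSubcategory := ⟨Y j, N, (h j).1⟩
      have hF := Cofan.isColimitMapCoconeEquiv F Y' _
        (isColimitOfPreserves F (isColimitCofanLift (Y := Y') hc h'))
      obtain ⟨hF'⟩ := isColimit_cofanι_minus hF
      exact isLE_cofan t' k hF' fun j ↦ (h j).2 _
  refine ⟨k + N, fun n X hX ↦ ?_⟩
  -- This shift moves `X` into T^{≤-N}, hence into Coprod(G(-∞,0]).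
  let X' := X⟦n + N⟧
  have h₁ : t.IsLE X'.obj (-N) := by
    have := t.isLE_shift X.obj n (n + N) (-N)
    exact ⟨(t.le (-N)).prop_of_iso ((t.minus.ι.commShiftIso (n + N)).symm.app X) this.le⟩
  have h₂ := (hS _ (hle _ h₁.le)).2 X'.property
  have h₃ : t'.IsLE ((F.obj X).obj⟦n + N⟧) k := ⟨(t'.le k).prop_of_iso
    (t'.minus.ι.mapIso ((F.commShiftIso (n + N)).app X) ≪≫
      (t'.minus.ι.commShiftIso (n + N)).app (F.obj X)) h₂.le⟩
  exact t'.isLE_of_shift _ _ (n + N) k (by lia)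

end Triangulated

section Restriction

variable {C : Type u} [Category.{v} C] [Preadditive C] [HasZeroObject C] [HasShift C ℤ]
  [∀ n : ℤ, (shiftFunctor C n).Additive] [Pretriangulated C]
  {D : Type u'} [Category.{v} D] [Preadditive D] [HasZeroObject D] [HasShift D ℤ]
  [∀ n : ℤ, (shiftFunctor D n).Additive] [Pretriangulated D]

lemma restrictsToEquivalence (F : C ⥤ D) [F.CommShift ℤ] [F.IsTriangulated] [F.IsEquivalence]
    {A : ObjectProperty C} {A' : ObjectProperty D} [A.IsTriangulated] [A'.IsTriangulated]
    [A'.IsClosedUnderIsomorphisms] (h : ∀ X, A X ↔ A' (F.obj X)) :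
    RestrictsToEquivalence F A A' := by
  refine ⟨inferInstance, inferInstance, fun X ↦ (h _).1 X.property, inferInstance, ?_⟩
  have : (A'.lift (A.ι ⋙ F) fun X ↦ (h _).1 X.property).EssSurj := ⟨fun Y ↦ by
    let e := F.objObjPreimageIso Y.obj
    exact ⟨⟨F.objPreimage Y.obj, (h _).2 (A'.prop_of_iso e.symm Y.property)⟩,
      ⟨A'.fullyFaithfulι.preimageIso e⟩⟩⟩
  have : (A'.lift (A.ι ⋙ F) fun X ↦ (h _).1 X.property).Full := inferInstance
  have : (A'.lift (A.ι ⋙ F) fun X ↦ (h _).1 X.property).Faithful := inferInstance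
  exact { }

end Restriction

/-! ### Compact objects are left orthogonal to very negative objects. -/

section Approximation

variable {C : Type u} [Category.{v} C] [Preadditive C] [HasZeroObject C] [HasShift C ℤ]
  [∀ n : ℤ, (shiftFunctor C n).Additive] [Pretriangulated C] {t : TStructure C} {G : C} {A : ℤ}

/-- The bound doubles because shifting `G` by at most `A` costs at most `A` more. -/
lemma retractClosure_coprodClosure_le_leftOrthogonal
    (hG : ∀ (Y : C) (f : G ⟶ Y), t.le (-A) Y → f = 0) :
    (coprodClosure (shiftsOf G (Set.Icc (-A) A))).retractClosure ≤
      (t.le (-2 * A)).leftOrthogonal := by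
  rintro E ⟨W, hW, ⟨r⟩⟩ Y f hY
  suffices shiftsOf G (Set.Icc (-A) A) ≤ (t.le (-2 * A)).leftOrthogonal by
    have h := coprodClosure_le_leftOrthogonal this _ hW (r.r ≫ f) hY
    rw [← Category.id_comp f, ← r.retract, Category.assoc, h, comp_zero]
  rintro Z ⟨i, ⟨hi, hi'⟩, ⟨e⟩⟩ Y g hY
  have : t.IsLE Y (-2 * A) := ⟨hY⟩
  have := t.isLE_shift Y (-2 * A) (-i) (-2 * A + i)
  have := t.isLE_of_le (Y⟦-i⟧) (-2 * A + i) (-A)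
  exact eq_zero_of_iso e (Iso.refl _) (eq_zero_of_forall_shift (-i)
    (eq_zero_of_iso (shiftShiftNeg G i) (Iso.refl _) fun k ↦ hG _ k (t.le_of_isLE _ _))) g

/-- An object `F` in `T^{≤ n}` has a morphism to an object of `T^{≤ n - 1}` through which all
the morphisms from `F` to objects of `T^{≤ n - 2A}` factor. -/
lemma exists_factorization (hG : ∀ (Y : C) (f : G ⟶ Y), t.le (-A) Y → f = 0)
    (happ : t.le 0 ≤ ObjectProperty.extensionProduct
      (coprodClosure (shiftsOf G (Set.Icc (-A) A))).retractClosure (t.le (-1)))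
    (n : ℤ) (F : C) (hF : t.IsLE F n) :
    ∃ (D : C) (g : F ⟶ D), t.IsLE D (n - 1) ∧
      ∀ (Y : C) (y : F ⟶ Y), t.IsLE Y (n - 2 * A) → ∃ y' : D ⟶ Y, g ≫ y' = y := by
  have := t.isLE_shift F n n 0
  obtain ⟨E, D, f, g, h, hT, hE, hD⟩ := happ (F⟦n⟧) (t.le_of_isLE _ _)
  have : t.IsLE D (-1) := ⟨hD⟩
  let e := shiftFunctorCompIsoId C n (-n) (add_neg_cancel n)
  refine ⟨D⟦-n⟧, e.inv.app F ≫ g⟦-n⟧', t.isLE_shift D (-1) (-n) (n - 1),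
    fun Y y _ ↦ ?_⟩
  have := t.isLE_shift Y (n - 2 * A) n (-2 * A)
  obtain ⟨y', hy'⟩ : ∃ y' : D ⟶ Y⟦n⟧, y⟦n⟧' = g ≫ y' :=
    Triangle.yoneda_exact₂ _ hT (y⟦n⟧')
      (retractClosure_coprodClosure_le_leftOrthogonal hG _ hE _ (t.le_of_isLE _ _))
  refine ⟨y'⟦-n⟧' ≫ e.hom.app Y, ?_⟩
  rw [Category.assoc, ← Functor.map_comp_assoc, ← hy', shift_shift_neg']
  simp [e]

variable [HasCoproducts.{v} C]

/-- In a weakly approximable category, a compact object has no nonzero morphism to the objects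
that are sufficiently negative for the given t-structure. -/
lemma exists_isLE_orthogonal_of_approximation (hG : IsCompactGenerator G) (hGA : t.IsLE G A)
    (hG' : ∀ (Y : C) (f : G ⟶ Y), t.le (-A) Y → f = 0)
    (happ : t.le 0 ≤ ObjectProperty.extensionProduct
      (coprodClosure (shiftsOf G (Set.Icc (-A) A))).retractClosure (t.le (-1)))
    {E : C} (hE : compactObjects C E) :
    ∃ M : ℤ, ∀ (Y : C) (y : E ⟶ Y), t.IsLE Y M → y = 0 := by
  obtain ⟨m, hm⟩ := hG.compactObjects_le_minus ⟨A, hGA⟩ E hE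
  choose D g hD hfac using exists_factorization hG' happ
  -- Iterating the approximation of `E` lowers the bound by one at each stage.
  let X (k : ℕ) : { Z : C // t.IsLE Z (m - k) } :=
    Nat.rec ⟨E, by simpa using hm⟩ (fun k Z ↦ ⟨D (m - k) Z.1 Z.2, by
      have := hD (m - k) Z.1 Z.2
      exact t.isLE_of_le _ (m - k - 1) _⟩) k
  let τ (k : ℕ) : (X k).1 ⟶ (X (k + 1)).1 := g (m - k) (X k).1 (X k).2
  let p (k : ℕ) : E ⟶ (X k).1 := Nat.rec (𝟙 E) (fun k q ↦ q ≫ τ k) k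
  obtain ⟨n, hn⟩ := hG.exists_eq_zero hE (fun k ↦ (X k).1) τ
    (fun i ↦ ⟨(m + i + A).toNat, fun k hk ↦ eq_zero_of_forall_shift (-i)
      (eq_zero_of_iso (shiftShiftNeg G i) (Iso.refl _) fun f ↦ hG' _ f (by
        have := (X k).2
        have := t.isLE_shift (X k).1 (m - k) (-i) (m - k + i)
        exact (t.isLE_of_le _ (m - k + i) (-A)).le))⟩) p (fun k ↦ rfl)
  -- Negative enough for `y` to factor through all of the first `n` stages, hence through `p n = 0`.
  refine ⟨m - n - 2 * A, fun Y y _ ↦ ?_⟩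
  have key (k : ℕ) (hk : k ≤ n) : ∃ z : (X k).1 ⟶ Y, p k ≫ z = y := by
    induction k with
    | zero => exact ⟨y, Category.id_comp y⟩
    | succ k hk' =>
      obtain ⟨z, hz⟩ := hk' (by lia)
      obtain ⟨z', hz'⟩ := hfac (m - k) (X k).1 (X k).2 Y z
        (t.isLE_of_le Y (m - n - 2 * A) _)
      refine ⟨z', ?_⟩
      change (p k ≫ τ k) ≫ z' = y
      rw [Category.assoc, hz', hz]
  obtain ⟨z, rfl⟩ := key n le_rfl
  rw [hn, zero_comp]

/-- The t-structure `t₀` of the approximation may differ from `t`; as `G` is compact it is bounded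
above for `t₀`, so aisles of `t` lie in aisles of `t₀` up to a shift. -/
lemma IsPreferred.exists_isLE_orthogonal (ht : IsPreferred t) (hC : IsWeaklyApproximable C)
    {E : C} (hE : compactObjects C E) :
    ∃ M : ℤ, ∀ (Y : C) (y : E ⟶ Y), t.IsLE Y M → y = 0 := by
  obtain ⟨A₀, G₀, t₀, -, hG₀, hGA, hG', happ⟩ := hC
  obtain ⟨G, N, hG, -, hle⟩ := ht.exists_generator
  obtain ⟨M, hM⟩ := exists_isLE_orthogonal_of_approximation hG₀ ⟨hGA⟩ hG' happ hE
  obtain ⟨k, hk⟩ := hG₀.compactObjects_le_minus (t := t₀) ⟨A₀, ⟨hGA⟩⟩ G hG.1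
  refine ⟨M - k - N, fun Y y _ ↦ hM Y y ?_⟩
  have := t.isLE_shift Y (M - k - N) (M - k) (-N)
  have : t₀.IsLE (Y⟦M - k⟧) k := ⟨coprodClosure_shiftsOf_le hk _ (hle _ (t.le_of_isLE _ _))⟩
  exact t₀.isLE_of_shift Y M (M - k) k

end Approximation

/-! ### The subcategory T^-_c and its invariance. -/

section PseudoCompact

open ObjectProperty

variable {C : Type u} [Category.{v} C] [Preadditive C] [HasZeroObject C] [HasShift C ℤ]
  [∀ n : ℤ, (shiftFunctor C n).Additive] [Pretriangulated C] {t : TStructure C}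

instance : (pseudoCompact t).IsClosedUnderIsomorphisms where
  of_iso e h m hm := prop_of_iso _ e (h m hm)

instance (n : ℤ) : (t.le n).ContainsZero where
  exists_zero := ⟨_, isZero_zero C, t.le_of_isLE _ n⟩

lemma extensionProduct_le_le (n : ℤ) : extensionProduct (t.le n) (t.le n) ≤ t.le n :=
  fun _ ⟨_, _, _, _, _, hT, h, h'⟩ ↦ (t.isLE₂ _ hT n ⟨h⟩ ⟨h'⟩).le

lemma extensionProduct_compactObjects_le :
    extensionProduct (compactObjects C) (compactObjects C) ≤ compactObjects C :=
  fun _ ⟨_, _, _, _, _, hT, h, h'⟩ ↦ ext_of_isTriangulatedClosed₂ _ _ hT h h'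

lemma pseudoCompact_le_minus (h : compactObjects C ≤ t.minus) : pseudoCompact t ≤ t.minus := by
  intro X hX
  obtain ⟨E, D, f, g, k, hT, hE, hD⟩ := hX 1 (by simp)
  exact ext_of_isTriangulatedClosed₂ t.minus _ hT (h _ hE) ⟨-1, ⟨hD⟩⟩

/-- Extensions that are split can be written in the opposite order. -/
lemma extensionProduct_le_swap {P Q : ObjectProperty C}
    (h : ∀ (X Y : C) (f : X ⟶ Y⟦(1 : ℤ)⟧), Q X → P Y → f = 0) :
    extensionProduct P Q ≤ extensionProduct Q P := by
  rintro X ⟨Y, Z, f, g, k, hT, hY, hZ⟩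
  obtain ⟨e, -⟩ := exists_iso_binaryBiproduct_of_distTriang _ hT (h _ _ k hZ hY)
  exact prop_of_iso _ ((biprod.braiding Z Y) ≪≫ e.symm)
    ⟨Z, Y, _, _, _, binaryBiproductTriangle_distinguished Z Y, hZ, hY⟩

lemma isTriangulated_pseudoCompact [IsTriangulated C]
    (h : ∀ E, compactObjects C E → ∃ M : ℤ, ∀ (Y : C) (y : E ⟶ Y), t.IsLE Y M → y = 0) :
    (pseudoCompact t).IsTriangulated where
  exists_zero := ⟨_, isZero_zero C, fun _ _ ↦ le_extensionProduct_left _ _ (prop_zero _)⟩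
  isStableUnderShiftBy a := ⟨fun X hX m hm ↦ by
    obtain ⟨E, D, f, g, k, hT, hE, hD⟩ := hX (max 1 (m - a)) (by simp)
    refine ⟨_, _, _, _, _, Triangle.shift_distinguished _ hT a, compactObjects_shift hE a, ?_⟩
    have : t.IsLE D (- max 1 (m - a)) := ⟨hD⟩
    have := t.isLE_shift D (- max 1 (m - a)) a (- max 1 (m - a) - a)
    exact (t.isLE_of_le (D⟦a⟧) (- max 1 (m - a) - a) (-m)).le⟩
  toIsTriangulatedClosed₂ := .mk' fun T hT h₁ h₃ m hm ↦ by
    -- `E` is chosen first; `T.obj₁` is then approximated so finely that its negative part has only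
    -- split extensions by `E`, which lets the two middle factors be exchanged.
    obtain ⟨E, D, f, g, k, hT', hE, hD⟩ := h₃ m hm
    obtain ⟨M, hM⟩ := h E hE
    have hX : extensionProduct (extensionProduct (compactObjects C) (t.le (-max m (1 - M))))
        (extensionProduct (singleton E) (t.le (-m))) T.obj₂ :=
      ⟨_, _, _, _, _, hT, h₁ _ (by lia), ⟨E, D, f, g, k, hT', ⟨⟨⟩⟩, hD⟩⟩
    rw [extensionProduct_assoc, ← extensionProduct_assoc (t.le _)] at hX
    have hswap : extensionProduct (t.le (-max m (1 - M))) (singleton E) ≤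
        extensionProduct (compactObjects C) (t.le (-m)) := by
      refine (extensionProduct_le_swap ?_).trans ?_
      · rintro _ Y y ⟨⟨⟩⟩ hY
        have : t.IsLE Y (-max m (1 - M)) := ⟨hY⟩
        have := t.isLE_shift Y (-max m (1 - M)) 1 (-max m (1 - M) - 1)
        exact hM _ y (t.isLE_of_le _ (-max m (1 - M) - 1) M)
      · refine (monotone_extensionProduct_left _ ?_).trans
          (monotone_extensionProduct_right _ (t.le_monotone (by lia)))
        rintro _ ⟨⟨⟩⟩
        exact hE
    have hX' := monotone_extensionProduct_right _ (monotone_extensionProduct_left _ hswap) _ hX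
    rw [extensionProduct_assoc, ← extensionProduct_assoc (compactObjects C)] at hX'
    exact monotone_extensionProduct_right _ (extensionProduct_le_le (t := t) (-m)) _
      (monotone_extensionProduct_left _ extensionProduct_compactObjects_le _ hX')

variable [HasCoproducts.{v} C]
  {D : Type u'} [Category.{v} D] [Preadditive D] [HasZeroObject D] [HasShift D ℤ]
  [∀ n : ℤ, (shiftFunctor D n).Additive] [Pretriangulated D] [HasCoproducts.{v} D]
  {t' : TStructure D}

lemma IsPreferred.pseudoCompact_map (ht : IsPreferred t) (ht' : IsPreferred t')
    (F : t.minus.FullSubcategory ⥤ t'.minus.FullSubcategory) [F.CommShift ℤ] [F.IsTriangulated]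
    [F.IsEquivalence] (X : t.minus.FullSubcategory) (hX : pseudoCompact t X.obj) :
    pseudoCompact t' (F.obj X).obj := by
  intro m hm
  obtain ⟨K, hK⟩ := ht.exists_isLE_map F (t' := t')
  -- `F` raises upper bounds by at most `K`; the maximum with 1 keeps the index positive.
  obtain ⟨E, B, f, g, k, hT, hE, hB⟩ := hX (max 1 (m + K)) (by simp)
  obtain ⟨hE', hc⟩ := (ht.compactObjects_iff E).1 hE
  have hB' : t.IsLE B (-max 1 (m + K)) := ⟨hB⟩
  obtain ⟨δ, hT'⟩ := exists_distTriang_fullSubcategory (P := t.minus)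
    (X₁ := ⟨E, hE'⟩) (X₂ := X) (X₃ := ⟨B, _, hB'⟩) hT
  refine ⟨_, _, _, _, _, t'.minus.ι.map_distinguished _ (F.map_distinguished _ hT'),
    (ht'.compactObjects_iff _).2 ⟨_, compactObjects_map F hc⟩, ?_⟩
  have := hK _ ⟨B, _, hB'⟩ hB'
  exact (t'.isLE_of_le (F.obj ⟨B, _, hB'⟩).obj (-max 1 (m + K) + K) (-m)).le

lemma IsPreferred.pseudoCompact_of_functor_obj (ht : IsPreferred t) (ht' : IsPreferred t')
    (e : t.minus.FullSubcategory ≌ t'.minus.FullSubcategory) [e.functor.CommShift ℤ]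
    [e.functor.IsTriangulated] (X : t.minus.FullSubcategory)
    (h : pseudoCompact t' (e.functor.obj X).obj) : pseudoCompact t X.obj := by
  let := e.commShiftInverse ℤ
  have : e.CommShift ℤ := e.commShift_of_functor ℤ
  have : e.IsTriangulated := .mk' e inferInstance
  exact prop_of_iso _ (t.minus.ι.mapIso (e.unitIso.app X).symm)
    (ht'.pseudoCompact_map ht e.inverse (e.functor.obj X) h)

lemma IsPreferred.pseudoCompact_map_iff (ht : IsPreferred t) (ht' : IsPreferred t')
    (F : t.minus.FullSubcategory ⥤ t'.minus.FullSubcategory) [F.CommShift ℤ] [F.IsTriangulated]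
    [F.IsEquivalence] (X : t.minus.FullSubcategory) :
    pseudoCompact t X.obj ↔ pseudoCompact t' (F.obj X).obj := by
  refine ⟨ht.pseudoCompact_map ht' F X, fun h ↦ ?_⟩
  let : F.asEquivalence.functor.CommShift ℤ := ‹F.CommShift ℤ›
  have : F.asEquivalence.functor.IsTriangulated := ‹F.IsTriangulated›
  exact ht.pseudoCompact_of_functor_obj ht' F.asEquivalence X h

end PseudoCompact

end WeakApprox

theorem lemmaL4p1 {T : Type u} [Category.{v} T] [Preadditive T] [HasZeroObject T]
    [HasShift T ℤ] [∀ n : ℤ, (shiftFunctor T n).Additive] [Pretriangulated T]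
    [IsTriangulated T] [HasCoproducts.{v} T]
    (hT : WeakApprox.IsWeaklyApproximable T)
    (t : TStructure T) (ht : WeakApprox.IsPreferred t) :
    -- `(T^-)^c = T^c`
    (∀ X : T, WeakApprox.compactObjects T X ↔
      ∃ h : t.minus X, WeakApprox.compactObjects t.minus.FullSubcategory ⟨X, h⟩) ∧
    -- `T^-_c` is contained in `T^-`
    WeakApprox.pseudoCompact t ≤ t.minus ∧
    -- the three inclusions are invariant under triangulated equivalences
    ∀ {T' : Type u'} [Category.{v} T'] [Preadditive T'] [HasZeroObject T']
      [HasShift T' ℤ] [∀ n : ℤ, (shiftFunctor T' n).Additive] [Pretriangulated T']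
      [IsTriangulated T'] [HasCoproducts.{v} T']
      (_ : WeakApprox.IsWeaklyApproximable T')
      (t' : TStructure T') (_ : WeakApprox.IsPreferred t'),
      (∀ (F : t.minus.FullSubcategory ⥤ t'.minus.FullSubcategory) [F.CommShift ℤ]
        [F.IsTriangulated] [F.IsEquivalence],
        WeakApprox.RestrictsToEquivalence F
          (t.bounded.inverseImage t.minus.ι) (t'.bounded.inverseImage t'.minus.ι) ∧
        WeakApprox.RestrictsToEquivalence F
          ((WeakApprox.pseudoCompact t).inverseImage t.minus.ι)
          ((WeakApprox.pseudoCompact t').inverseImage t'.minus.ι)) ∧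
      (∀ (F : t.plus.FullSubcategory ⥤ t'.plus.FullSubcategory) [F.CommShift ℤ]
        [F.IsTriangulated] [F.IsEquivalence],
        WeakApprox.RestrictsToEquivalence F
          (t.bounded.inverseImage t.plus.ι) (t'.bounded.inverseImage t'.plus.ι)) := by
  refine ⟨ht.compactObjects_iff,
    WeakApprox.pseudoCompact_le_minus ht.compactObjects_le_minus, ?_⟩
  intro T' _ _ _ _ _ _ _ _ hT' t' ht'
  refine ⟨fun F _ _ _ ↦ ⟨?_, ?_⟩, fun F _ _ _ ↦ ?_⟩
  · refine WeakApprox.restrictsToEquivalence F fun X ↦ ?_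
    exact (ht.bounded_iff_of_minus X).trans
      ((WeakApprox.forall_compact_eventuallyZero_map_iff F X).symm.trans
        (ht'.bounded_iff_of_minus (F.obj X)).symm)
  · have := WeakApprox.isTriangulated_pseudoCompact fun _ ↦ ht.exists_isLE_orthogonal hT
    have := WeakApprox.isTriangulated_pseudoCompact fun _ ↦ ht'.exists_isLE_orthogonal hT'
    exact WeakApprox.restrictsToEquivalence F (ht.pseudoCompact_map_iff ht' F)
  · refine WeakApprox.restrictsToEquivalence F fun X ↦ ?_
    exact (ht.bounded_iff_of_plus X).trans
      ((WeakApprox.forall_eventuallyZero_map_iff F X).symm.trans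
        (ht'.bounded_iff_of_plus (F.obj X)).symm)
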